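/- **Proposition.** Let $\mathcal H,\mathcal Z$ be complex Hilbert spaces (not necessarily separable) with $\mathcal Z\neq\{0\}$. Write $\mathcal B^1(\cdot)$ for the trace class with the trace norm, $\mathcal B(\mathcal B^1(\mathcal H),\mathcal B^1(\mathcal Z))$ for the bounded linear maps between the trace classes, $\mathcal H\otimes\mathcal Z$ for the Hilbert space tensor product, and $|x\rangle\langle y|$ for the operator $z\mapsto\langle y,z\rangle x$. For an orthonormal basis $G=\{g_j\}_{j\in J}$ of $\mathcal H$ and $\lambda\in\ell^1(J,\mathbb C)$ consider the weighted Choi map $$\mathsf C_{\lambda,G}:\mathcal B(\mathcal B^1(\mathcal H),\mathcal B^1(\mathcal Z))\to\mathcal B^1(\mathcal H\otimes\mathcal Z),\qquad \Phi\mapsto\sum_{j,k\in J}\overline{\lambda_j}\,\lambda_k\,|g_j\rangle\langle g_k|\otimes\Phi(|g_j\rangle\langle g_k|).$$ For every orthonormal basis $G=\{g_j\}_{j\in J}$ of $\mathcal H$ and every $\lambda\in\ell^1(J,\mathbb C)$, the map $\mathsf C_{\lambda,G}$ is well defined (for every $\Phi$ the family is summable, as an unordered sum, in trace norm), and (i)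 $\mathsf C_{\lambda,G}$ is injective if and only if $\mathcal H$ is separable and $\lambda_j\neq0$ for all $j\in J$; (ii) $\mathsf C_{\lambda,G}$ is surjective if and only if $\mathcal H$ is finite-dimensional and $\lambda_j\neq0$ for all $j\in J$. Moreover, if $\dim\mathcal H=\infty$, then there exists a positive semi-definite trace-class operator $Y$ on $\mathcal H\otimes\mathcal Z$ such that $\mathsf C_{\lambda,G}^{-1}(\{Y\})=\emptyset$ for every orthonormal basis $G=\{g_j\}_{j\in J}$ of $\mathcal H$ and every $\lambda\in\ell^1(J,\mathbb C)$. -/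

import Mathlib

open scoped InnerProductSpace TensorProduct
open InnerProductSpace

/-- `X = ∑_{j ∈ N} s_j |f_j⟩⟨g_j|` in operator norm, with orthonormal systems `f`, `g` and `s_j > 0`.
The order of the singular values `s_j` is irrelevant below, so none is imposed. -/
structure IsSchmidtDecomposition {H : Type*} [NormedAddCommGroup H] [InnerProductSpace ℂ H]
    (X : H →L[ℂ] H) (N : Set ℕ) (s : N → ℝ) (f g : N → H) : Prop where
  orthonormal_left : Orthonormal ℂ f
  orthonormal_right : Orthonormal ℂ g
  pos : ∀ j, 0 < s j
  hasSum : HasSum (fun j => (s j : ℂ) • rankOne ℂ (f j) (g j)) X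

/-- `X` is trace class: it has a Schmidt decomposition with summable singular values. -/
def IsTraceClass {H : Type*} [NormedAddCommGroup H] [InnerProductSpace ℂ H]
    (X : H →L[ℂ] H) : Prop :=
  ∃ (N : Set ℕ) (s : N → ℝ) (f g : N → H), IsSchmidtDecomposition X N s f g ∧ Summable s

/-- The trace norm, the sum of the singular values. All Schmidt decompositions of a trace-class
operator give the same sum, see `IsSchmidtDecomposition.traceNorm_eq`. -/
noncomputable def traceNorm {H : Type*} [NormedAddCommGroup H] [InnerProductSpace ℂ H]
    (X : H →L[ℂ] H) : ℝ :=
  sInf {r : ℝ | ∃ (N : Set ℕ) (s : N → ℝ) (f g : N → H),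
    IsSchmidtDecomposition X N s f g ∧ HasSum s r}

section Nuclear

universe u

variable {H : Type u} [NormedAddCommGroup H] [InnerProductSpace ℂ H]

theorem nuclear_inner_bound {ι κ : Type*} {T : H →L[ℂ] H} {x y : ι → H} {f g : κ → H}
    (hT : HasSum (fun i => rankOne ℂ (x i) (y i)) T)
    (hs : Summable fun i => ‖x i‖ * ‖y i‖) (hf : Orthonormal ℂ f) (hg : Orthonormal ℂ g)
    (F : Finset κ) :
    ∑ j ∈ F, ‖⟪f j, T (g j)⟫_ℂ‖ ≤ ∑' i, ‖x i‖ * ‖y i‖ := by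
  have hb : ∀ i, ∑ j ∈ F, ‖⟪f j, x i⟫_ℂ‖ * ‖⟪g j, y i⟫_ℂ‖ ≤ ‖x i‖ * ‖y i‖ := by
    intro i
    refine (Real.sum_mul_le_sqrt_mul_sqrt _ _ _).trans ?_
    gcongr
    · exact Real.sqrt_le_iff.2 ⟨norm_nonneg _, hf.sum_inner_products_le _⟩
    · exact Real.sqrt_le_iff.2 ⟨norm_nonneg _, hg.sum_inner_products_le _⟩
  have hsj : ∀ j ∈ F, Summable fun i => ‖⟪f j, x i⟫_ℂ‖ * ‖⟪g j, y i⟫_ℂ‖ := fun j hj =>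
    Summable.of_nonneg_of_le (fun i => by positivity)
      (fun i => (Finset.single_le_sum (f := fun j => ‖⟪f j, x i⟫_ℂ‖ * ‖⟪g j, y i⟫_ℂ‖)
        (fun j _ => by positivity) hj).trans (hb i)) hs
  have hj : ∀ j ∈ F, ‖⟪f j, T (g j)⟫_ℂ‖ ≤ ∑' i, ‖⟪f j, x i⟫_ℂ‖ * ‖⟪g j, y i⟫_ℂ‖ := by
    intro j hj
    have h1 : HasSum (fun i => ⟪y i, g j⟫_ℂ * ⟪f j, x i⟫_ℂ) ⟪f j, T (g j)⟫_ℂ := by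
      have := (hT.mapL (ContinuousLinearMap.apply ℂ H (g j))).mapL (innerSL ℂ (f j))
      simpa [inner_smul_right] using this
    have h2 : ∀ i, ‖⟪y i, g j⟫_ℂ * ⟪f j, x i⟫_ℂ‖ = ‖⟪f j, x i⟫_ℂ‖ * ‖⟪g j, y i⟫_ℂ‖ := by
      intro i; rw [norm_mul, mul_comm, norm_inner_symm (y i)]
    rw [← h1.tsum_eq, ← tsum_congr h2]
    exact norm_tsum_le_tsum_norm ((hsj j hj).congr fun i => (h2 i).symm)
  calc _ ≤ ∑ j ∈ F, ∑' i, ‖⟪f j, x i⟫_ℂ‖ * ‖⟪g j, y i⟫_ℂ‖ := Finset.sum_le_sum hj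
    _ = ∑' i, ∑ j ∈ F, ‖⟪f j, x i⟫_ℂ‖ * ‖⟪g j, y i⟫_ℂ‖ := (Summable.tsum_finsetSum hsj).symm
    _ ≤ _ := (summable_sum hsj).tsum_le_tsum hb hs

theorem IsSchmidtDecomposition.inner_apply {X : H →L[ℂ] H} {N : Set ℕ} {s : N → ℝ} {f g : N → H}
    (h : IsSchmidtDecomposition X N s f g) (j : N) : ⟪f j, X (g j)⟫_ℂ = s j := by
  classical
  have h1 := (h.hasSum.mapL (ContinuousLinearMap.apply ℂ H (g j))).mapL (innerSL ℂ (f j))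
  have h2 : HasSum (fun i => if i = j then (s j : ℂ) else 0) (s j : ℂ) := hasSum_ite_eq j _
  refine h1.unique (h2.congr_fun ?_) 
  intro i
  by_cases hij : i = j
  · subst hij
    simp [h.orthonormal_left.1, h.orthonormal_right.1]
  · simp [h.orthonormal_right.2 hij, hij]

theorem nuclear_schmidt_sum_le {ι : Type*} {T : H →L[ℂ] H} {x y : ι → H}
    (hT : HasSum (fun i => rankOne ℂ (x i) (y i)) T) (hs : Summable fun i => ‖x i‖ * ‖y i‖)
    {N : Set ℕ} {s : N → ℝ} {f g : N → H} (h : IsSchmidtDecomposition T N s f g) :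
    Summable s ∧ ∑' j, s j ≤ ∑' i, ‖x i‖ * ‖y i‖ := by
  have hF : ∀ F : Finset N, ∑ j ∈ F, s j ≤ ∑' i, ‖x i‖ * ‖y i‖ := by
    intro F
    refine le_trans (le_of_eq (Finset.sum_congr rfl fun j _ => ?_))
      (nuclear_inner_bound hT hs h.orthonormal_left h.orthonormal_right F)
    rw [h.inner_apply]; simp [abs_of_pos (h.pos j)]
  have h1 := summable_of_sum_le (fun j => (h.pos j).le) hF
  exact ⟨h1, h1.tsum_le_of_sum_le hF⟩

theorem nuclear_isCompact [CompleteSpace H] {ι : Type*} {T : H →L[ℂ] H} {x y : ι → H}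
    (hT : HasSum (fun i => rankOne ℂ (x i) (y i)) T) : IsCompactOperator T := by
  refine isCompactOperator_of_tendsto hT (Filter.Eventually.of_forall fun F => ?_)
  classical
  have h1 : ∀ i, IsCompactOperator (rankOne ℂ (x i) (y i)) := by
    intro i
    have : IsCompactOperator (id : ℂ → ℂ) := isCompactOperator_id_iff_finiteDimensional (𝕜 := ℂ) |>.2 inferInstance
    have h2 : IsCompactOperator (innerSL ℂ (y i)) := this.comp_clm (innerSL ℂ (y i))
    have h3 := h2.clm_comp (ContinuousLinearMap.toSpanSingleton ℂ (x i))
    exact h3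
  exact Submodule.sum_mem (compactOperator (RingHom.id ℂ) H H) (fun i _ => h1 i)

theorem exists_eigenbasis [CompleteSpace H] (T : H →L[ℂ] H) (hT : IsCompactOperator T) :
    ∃ (κ : Type u) (e : HilbertBasis κ ℂ H), ∀ i j, i ≠ j → ⟪T (e i), T (e j)⟫_ℂ = 0 := by
  obtain ⟨S, hS⟩ : ∃ S : H →L[ℂ] H, S = T.adjoint ∘L T := ⟨_, rfl⟩
  have hc : IsCompactOperator S := by rw [hS]; exact hT.clm_comp T.adjoint
  have hsym : (S : H →ₗ[ℂ] H).IsSymmetric := by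
    intro u v
    simp [hS, ContinuousLinearMap.adjoint_inner_left, ContinuousLinearMap.adjoint_inner_right]
  obtain ⟨V, hV⟩ : ∃ V : ℂ → Submodule ℂ H, V = Module.End.eigenspace (S : H →ₗ[ℂ] H) := ⟨_, rfl⟩
  have hmem : ∀ μ v, v ∈ V μ ↔ S v = μ • v := fun μ v => by
    rw [hV]; exact Module.End.mem_eigenspace_iff
  have hbot : (⨆ μ, V μ)ᗮ = ⊥ := by
    rw [hV]; exact ContinuousLinearMap.orthogonalComplement_iSup_eigenspaces_eq_bot hc hsym
  have hfam : OrthogonalFamily ℂ (fun μ => V μ) fun μ => (V μ).subtypeₗᵢ := by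
    subst hV; exact hsym.orthogonalFamily_eigenspaces
  have hcl : ∀ μ : ℂ, CompleteSpace (V μ) := by
    intro μ
    have : IsClosed (V μ : Set H) := by
      have h2 : (V μ : Set H) = {v | S v = μ • v} := by
        ext v; exact hmem μ v
      rw [h2]
      exact isClosed_eq (by fun_prop) (by fun_prop)
    exact this.completeSpace_coe
  clear hV
  choose w b hb using fun μ : ℂ => exists_hilbertBasis ℂ (V μ)
  have ho : Orthonormal ℂ fun a : Σ μ, w μ => ((b a.1 a.2 : V a.1) : H) :=
    hfam.orthonormal_sigma_orthonormal (fun μ => (b μ).orthonormal)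
  have hspan : (Submodule.span ℂ (Set.range fun a : Σ μ, w μ => ((b a.1 a.2 : V a.1) : H)))ᗮ
      = ⊥ := by
    rw [← le_bot_iff, ← hbot]
    intro v hv
    rw [Submodule.mem_orthogonal] at hv
    rw [← Submodule.iInf_orthogonal, Submodule.mem_iInf]
    intro μ
    rw [Submodule.mem_orthogonal]
    intro u hu
    have h4 := (((b μ).hasSum_repr ⟨u, hu⟩).mapL (V μ).subtypeL).mapL (innerSL ℂ v)
    have h5 : ⟪v, u⟫_ℂ = 0 := by
      refine h4.unique (hasSum_zero.congr_fun ?_)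
      intro i
      have h6 := hv _ (Submodule.subset_span ⟨⟨μ, i⟩, rfl⟩)
      have h7 : ⟪v, ((b μ i : V μ) : H)⟫_ℂ = 0 := inner_eq_zero_symm.1 h6
      simp [h7]
    exact inner_eq_zero_symm.1 h5
  refine ⟨_, HilbertBasis.mkOfOrthogonalEqBot ho hspan, ?_⟩
  intro i j hij
  rw [HilbertBasis.coe_mkOfOrthogonalEqBot, ← ContinuousLinearMap.adjoint_inner_right]
  have h8 : T.adjoint (T (b j.1 j.2 : V j.1)) = j.1 • ((b j.1 j.2 : V j.1) : H) := by
    have := (hmem j.1 _).1 (b j.1 j.2).2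
    rwa [hS] at this
  rw [h8, inner_smul_right, ho.2 hij, mul_zero]

theorem exists_compact_svd [CompleteSpace H] (T : H →L[ℂ] H) (hT : IsCompactOperator T) :
    ∃ (κ : Type u) (s : κ → ℝ) (f g : κ → H), Orthonormal ℂ f ∧ Orthonormal ℂ g ∧
      (∀ i, 0 < s i) ∧ (∀ i, T (g i) = (s i : ℂ) • f i) ∧
      ∀ v, HasSum (fun i => ⟪g i, v⟫_ℂ • T (g i)) (T v) := by
  obtain ⟨κ, e, he⟩ := exists_eigenbasis T hT
  have hpos : ∀ i : {i : κ // T (e i) ≠ 0}, 0 < ‖T (e i)‖ := fun i => norm_pos_iff.2 i.2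
  refine ⟨{i : κ // T (e i) ≠ 0}, fun i => ‖T (e i)‖,
    fun i => ((‖T (e i)‖ : ℂ)⁻¹) • T (e i), fun i => e i, ⟨?_, ?_⟩,
    e.orthonormal.comp _ Subtype.val_injective, hpos, ?_, ?_⟩
  · intro i
    simp only [norm_smul, norm_inv, Complex.norm_real, norm_norm]
    exact inv_mul_cancel₀ (hpos i).ne'
  · intro i j hij
    simp only [inner_smul_left, inner_smul_right]
    rw [he _ _ (fun h => hij (Subtype.ext h)), mul_zero, mul_zero]
  · intro i
    simp only []
    rw [smul_smul, mul_inv_cancel₀, one_smul]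
    exact_mod_cast (hpos i).ne'
  · intro v
    have h4 := (e.hasSum_repr v).mapL T
    simp only [map_smul, e.repr_apply_apply] at h4
    refine (hasSum_subtype_iff_of_support_subset (s := {i | T (e i) ≠ 0}) ?_).2 h4
    intro i hi h0
    simp [h0] at hi

theorem nuclear_exists_schmidt [CompleteSpace H] {ι : Type*} {T : H →L[ℂ] H} {x y : ι → H}
    (hT : HasSum (fun i => rankOne ℂ (x i) (y i)) T) (hs : Summable fun i => ‖x i‖ * ‖y i‖) :
    ∃ (N : Set ℕ) (s : N → ℝ) (f g : N → H), IsSchmidtDecomposition T N s f g := by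
  obtain ⟨κ, s, f, g, hf, hg, hpos, hsf, hv⟩ := exists_compact_svd T (nuclear_isCompact hT)
  have hsum : Summable s := by
    refine summable_of_sum_le (fun j => (hpos j).le) (c := ∑' i, ‖x i‖ * ‖y i‖) fun F => ?_
    refine le_trans (le_of_eq (Finset.sum_congr rfl fun j _ => ?_))
      (nuclear_inner_bound hT hs hf hg F)
    rw [hsf j, inner_smul_right, inner_self_eq_norm_sq_to_K, hf.1]
    simp [abs_of_pos (hpos j)]
  have hcount : Countable κ := by
    have h := hsum.countable_support
    have h2 : Function.support s = Set.univ := Set.eq_univ_of_forall fun i => (hpos i).ne'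
    rw [h2] at h
    exact Set.countable_univ_iff.1 h
  have hop : HasSum (fun i => (s i : ℂ) • rankOne ℂ (f i) (g i)) T := by
    have h1 : Summable (fun i => (s i : ℂ) • rankOne ℂ (f i) (g i)) := by
      refine Summable.of_norm (hsum.congr fun i => ?_)
      simp [norm_smul, hf.1, hg.1, abs_of_pos (hpos i)]
    have h2 : (∑' i, (s i : ℂ) • rankOne ℂ (f i) (g i)) = T := by
      ext v
      have h3 := h1.hasSum.mapL (ContinuousLinearMap.apply ℂ H v)
      refine h3.unique ((hv v).congr_fun fun i => ?_)
      rw [hsf, smul_comm]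
      rfl
    rw [← h2]
    exact h1.hasSum
  obtain ⟨φ, hφ⟩ := Countable.exists_injective_nat κ
  let E := Equiv.ofInjective φ hφ
  have hE : HasSum (fun j => (s (E.symm j) : ℂ) • rankOne ℂ (f (E.symm j)) (g (E.symm j))) T :=
    (E.symm.hasSum_iff (f := fun i => (s i : ℂ) • rankOne ℂ (f i) (g i))).2 hop
  exact ⟨Set.range φ, fun j => s (E.symm j), fun j => f (E.symm j), fun j => g (E.symm j),
    ⟨hf.comp _ E.symm.injective, hg.comp _ E.symm.injective, fun j => hpos _, hE⟩⟩

theorem IsSchmidtDecomposition.nuclear {X : H →L[ℂ] H} {N : Set ℕ} {s : N → ℝ} {f g : N → H}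
    (h : IsSchmidtDecomposition X N s f g) :
    HasSum (fun j => rankOne ℂ ((s j : ℂ) • f j) (g j)) X ∧
      ∀ j, ‖(s j : ℂ) • f j‖ * ‖g j‖ = s j := by
  refine ⟨by simpa using h.hasSum, fun j => ?_⟩
  simp [norm_smul, h.orthonormal_left.1, h.orthonormal_right.1, abs_of_pos (h.pos j)]

theorem IsSchmidtDecomposition.traceNorm_eq {X : H →L[ℂ] H} {N : Set ℕ} {s : N → ℝ} {f g : N → H}
    (h : IsSchmidtDecomposition X N s f g) (hs : Summable s) : traceNorm X = ∑' j, s j := by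
  have key : {r : ℝ | ∃ (N : Set ℕ) (s : N → ℝ) (f g : N → H),
      IsSchmidtDecomposition X N s f g ∧ HasSum s r} = {∑' j, s j} := by
    refine Set.eq_singleton_iff_unique_mem.2 ⟨⟨N, s, f, g, h, hs.hasSum⟩, ?_⟩
    rintro r ⟨N', s', f', g', h', hs'⟩
    rw [← hs'.tsum_eq]
    have e : ∀ j, ‖(s j : ℂ) • f j‖ * ‖g j‖ = s j := h.nuclear.2
    have e' : ∀ j, ‖(s' j : ℂ) • f' j‖ * ‖g' j‖ = s' j := h'.nuclear.2
    refine le_antisymm ?_ ?_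
    · refine (nuclear_schmidt_sum_le h.nuclear.1 (hs.congr fun j => (e j).symm) h').2.trans_eq (tsum_congr e)
    · refine (nuclear_schmidt_sum_le h'.nuclear.1 (hs'.summable.congr fun j => (e' j).symm) h).2.trans_eq
        (tsum_congr e')
  rw [traceNorm, key, csInf_singleton]

theorem nuclear_isTraceClass [CompleteSpace H] {ι : Type*} {T : H →L[ℂ] H} {x y : ι → H}
    (hT : HasSum (fun i => rankOne ℂ (x i) (y i)) T) (hs : Summable fun i => ‖x i‖ * ‖y i‖) :
    IsTraceClass T ∧ traceNorm T ≤ ∑' i, ‖x i‖ * ‖y i‖ := by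
  obtain ⟨N, s, f, g, h⟩ := nuclear_exists_schmidt hT hs
  obtain ⟨h1, h2⟩ := nuclear_schmidt_sum_le hT hs h
  exact ⟨⟨N, s, f, g, h, h1⟩, (h.traceNorm_eq h1).trans_le h2⟩

theorem IsTraceClass.exists_nuclear {X : H →L[ℂ] H} (h : IsTraceClass X) :
    ∃ (N : Set ℕ) (x y : N → H), HasSum (fun i => rankOne ℂ (x i) (y i)) X ∧
      HasSum (fun i => ‖x i‖ * ‖y i‖) (traceNorm X) := by
  obtain ⟨N, s, f, g, h, hs⟩ := h
  refine ⟨N, _, g, h.nuclear.1, ?_⟩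
  rw [h.traceNorm_eq hs]
  exact hs.hasSum.congr_fun (fun j => h.nuclear.2 j)

end Nuclear

section TraceClassSpace

variable (H : Type*) [NormedAddCommGroup H] [InnerProductSpace ℂ H] [CompleteSpace H]

variable {H} in
theorem IsTraceClass.add {X Y : H →L[ℂ] H} (hX : IsTraceClass X) (hY : IsTraceClass Y) :
    IsTraceClass (X + Y) ∧ traceNorm (X + Y) ≤ traceNorm X + traceNorm Y := by
  obtain ⟨N, x, y, h1, h2⟩ := hX.exists_nuclear
  obtain ⟨M, u, v, h3, h4⟩ := hY.exists_nuclear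
  have h5 : HasSum (fun i => rankOne ℂ (Sum.elim x u i) (Sum.elim y v i)) (X + Y) :=
    HasSum.sum (f := fun i => rankOne ℂ (Sum.elim x u i) (Sum.elim y v i)) h1 h3
  have h6 : HasSum (fun i => ‖Sum.elim x u i‖ * ‖Sum.elim y v i‖) (traceNorm X + traceNorm Y) :=
    HasSum.sum (f := fun i => ‖Sum.elim x u i‖ * ‖Sum.elim y v i‖) h2 h4
  have h7 := nuclear_isTraceClass h5 h6.summable
  exact ⟨h7.1, h7.2.trans_eq h6.tsum_eq⟩

variable {H} in
theorem IsTraceClass.smul {X : H →L[ℂ] H} (hX : IsTraceClass X) (c : ℂ) :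
    IsTraceClass (c • X) ∧ traceNorm (c • X) ≤ ‖c‖ * traceNorm X := by
  obtain ⟨N, x, y, h1, h2⟩ := hX.exists_nuclear
  have h5 : HasSum (fun i => rankOne ℂ (c • x i) (y i)) (c • X) := by
    simpa using h1.const_smul c
  have h6 : HasSum (fun i => ‖c • x i‖ * ‖y i‖) (‖c‖ * traceNorm X) := by
    simpa [norm_smul, mul_assoc] using h2.mul_left ‖c‖
  have h7 := nuclear_isTraceClass h5 h6.summable
  exact ⟨h7.1, h7.2.trans_eq h6.tsum_eq⟩

variable {H} in
theorem isTraceClass_zero : IsTraceClass (0 : H →L[ℂ] H) :=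
  (nuclear_isTraceClass (ι := Empty) (x := fun _ => 0) (y := fun _ => 0)
    (by simp) (by simp)).1

variable {H} in
theorem isTraceClass_rankOne (x y : H) : IsTraceClass (rankOne ℂ x y) :=
  (nuclear_isTraceClass (ι := Unit) (x := fun _ => x) (y := fun _ => y)
    (hasSum_unique _) (hasSum_unique _).summable).1

/-- The trace-class operators on `H`, as a linear subspace of the bounded operators. -/
def traceClassSubmodule : Submodule ℂ (H →L[ℂ] H) where
  carrier := {X | IsTraceClass X}
  add_mem' hX hY := (hX.add hY).1
  zero_mem' := isTraceClass_zero
  smul_mem' c _ hX := (hX.smul c).1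

/-- The trace class of `H`; its norm is the trace norm (not the operator norm). -/
def TraceClass : Type _ := traceClassSubmodule H

noncomputable instance : AddCommGroup (TraceClass H) :=
  inferInstanceAs (AddCommGroup (traceClassSubmodule H))

noncomputable instance : Module ℂ (TraceClass H) :=
  inferInstanceAs (Module ℂ (traceClassSubmodule H))

variable {H} in
/-- A trace-class operator as an element of the space `TraceClass H`. -/
def TraceClass.mk (X : H →L[ℂ] H) (hX : IsTraceClass X) : TraceClass H := ⟨X, hX⟩

variable {H} in
/-- The underlying bounded operator. -/
noncomputable def TraceClass.toCLM : TraceClass H →ₗ[ℂ] (H →L[ℂ] H) :=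
  (traceClassSubmodule H).subtype

variable {H} in
theorem TraceClass.isTraceClass (X : TraceClass H) : IsTraceClass X.toCLM := X.2

variable {H} in
theorem TraceClass.toCLM_injective : Function.Injective (TraceClass.toCLM (H := H)) :=
  Subtype.val_injective

noncomputable instance : Norm (TraceClass H) := ⟨fun X => traceNorm X.toCLM⟩

theorem TraceClass.normCore : NormedSpace.Core ℂ (TraceClass H) where
  norm_nonneg X := by
    obtain ⟨N, x, y, h1, h2⟩ := X.isTraceClass.exists_nuclear
    exact h2.nonneg fun i => by positivity
  norm_smul c X := by
    change traceNorm (c • X).toCLM = ‖c‖ * traceNorm X.toCLM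
    rw [map_smul]
    refine le_antisymm (X.isTraceClass.smul c).2 ?_
    by_cases hc : c = 0
    · subst hc
      obtain ⟨N, x, y, h1, h2⟩ := (X.isTraceClass.smul 0).1.exists_nuclear
      rw [norm_zero, zero_mul]
      exact h2.nonneg fun i => by positivity
    · have h := ((X.isTraceClass.smul c).1.smul c⁻¹).2
      rw [smul_smul, inv_mul_cancel₀ hc, one_smul, norm_inv] at h
      rwa [← le_inv_mul_iff₀ (norm_pos_iff.2 hc)]
  norm_triangle X Y := by
    change traceNorm (X + Y).toCLM ≤ _
    rw [map_add]
    exact (X.isTraceClass.add Y.isTraceClass).2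
  norm_eq_zero_iff X := by
    obtain ⟨N, x, y, h1, h2⟩ := X.isTraceClass.exists_nuclear
    constructor
    · intro h
      change traceNorm X.toCLM = 0 at h
      rw [h, hasSum_zero_iff_of_nonneg fun i => by positivity] at h2
      apply TraceClass.toCLM_injective
      rw [map_zero]
      refine h1.unique (hasSum_zero.congr_fun fun i => ?_)
      rw [← norm_eq_zero, norm_rankOne]
      exact congrFun h2 i
    · rintro rfl
      have h := (isTraceClass_zero (H := H).smul 0).2
      rw [norm_zero, zero_mul, smul_zero] at h
      exact le_antisymm h (by
        rw [map_zero] at h2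
        exact h2.nonneg fun i => by positivity)

noncomputable instance : NormedAddCommGroup (TraceClass H) :=
  NormedAddCommGroup.ofCore (TraceClass.normCore H)

noncomputable instance : NormedSpace ℂ (TraceClass H) :=
  NormedSpace.ofCore (TraceClass.normCore H)

theorem TraceClass.norm_def (X : TraceClass H) : ‖X‖ = traceNorm X.toCLM := rfl

variable {H} in
/-- The rank-one operator `|x⟩⟨y|`, `z ↦ ⟪y, z⟫ x`, as a trace-class operator. -/
noncomputable def TraceClass.ketbra (x y : H) : TraceClass H :=
  TraceClass.mk (rankOne ℂ x y) (isTraceClass_rankOne x y)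

end TraceClassSpace

section Tensor

variable (H Z : Type*) [NormedAddCommGroup H] [InnerProductSpace ℂ H]
  [NormedAddCommGroup Z] [InnerProductSpace ℂ Z]

/-- The Hilbert space tensor product: the completion of the algebraic tensor product with respect
to `⟪x ⊗ z, x' ⊗ z'⟫ = ⟪x, x'⟫ ⟪z, z'⟫`. -/
abbrev HilbertTensor : Type _ := UniformSpace.Completion (H ⊗[ℂ] Z)

variable {H Z}

/-- The elementary tensor `x ⊗ z`. -/
noncomputable def htmul (x : H) (z : Z) : HilbertTensor H Z := ((x ⊗ₜ[ℂ] z : H ⊗[ℂ] Z) : _)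

/-- The bounded operator `A ⊗ B` on `H ⊗ Z`, determined by `(A ⊗ B)(x ⊗ z) = A x ⊗ B z`. -/
noncomputable def tensorOp (A : H →L[ℂ] H) (B : Z →L[ℂ] Z) :
    HilbertTensor H Z →L[ℂ] HilbertTensor H Z :=
  (TensorProduct.mapL A B).completion

theorem tensorOp_htmul (A : H →L[ℂ] H) (B : Z →L[ℂ] Z) (x : H) (z : Z) :
    tensorOp A B (htmul x z) = htmul (A x) (B z) := by
  simp [tensorOp, htmul]

theorem htmul_inner (x x' : H) (z z' : Z) :
    ⟪htmul x z, htmul x' z'⟫_ℂ = ⟪x, x'⟫_ℂ * ⟪z, z'⟫_ℂ := by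
  simp [htmul]

theorem htmul_norm (x : H) (z : Z) : ‖htmul x z‖ = ‖x‖ * ‖z‖ := by
  simp [htmul]

theorem hilbertTensor_ext {E : Type*} [NormedAddCommGroup E] [NormedSpace ℂ E]
    {S T : HilbertTensor H Z →L[ℂ] E} (h : ∀ x z, S (htmul x z) = T (htmul x z)) : S = T := by
  ext v
  refine UniformSpace.Completion.induction_on v (isClosed_eq S.continuous T.continuous) fun a => ?_
  induction a using TensorProduct.induction_on with
  | zero => rw [UniformSpace.Completion.coe_zero, map_zero, map_zero]
  | tmul x z => exact h x z
  | add a b ha hb => rw [UniformSpace.Completion.coe_add, map_add, map_add, ha, hb]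

/-- The elementary tensor as a continuous bilinear map. -/
noncomputable def htmulL : H →L[ℂ] Z →L[ℂ] HilbertTensor H Z :=
  (ContinuousLinearMap.compL ℂ Z (H ⊗[ℂ] Z) (HilbertTensor H Z)
    UniformSpace.Completion.toComplL) ∘L (TensorProduct.mkL ℂ H Z)

theorem IsTraceClass.tensorOp {A : H →L[ℂ] H} {B : Z →L[ℂ] Z} (hA : IsTraceClass A)
    (hB : IsTraceClass B) : IsTraceClass (tensorOp A B) := by
  obtain ⟨N, x, y, h1, h2⟩ := hA.exists_nuclear
  obtain ⟨M, u, v, h3, h4⟩ := hB.exists_nuclear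
  have hs : Summable fun i : N × M => ‖htmul (x i.1) (u i.2)‖ * ‖htmul (y i.1) (v i.2)‖ := by
    refine (h2.summable.mul_of_nonneg h4.summable (fun i => by positivity)
      (fun i => by positivity)).congr fun i => ?_
    rw [htmul_norm, htmul_norm]; ring
  have hS : Summable fun i : N × M =>
      rankOne ℂ (htmul (x i.1) (u i.2)) (htmul (y i.1) (v i.2)) :=
    Summable.of_norm (hs.congr fun i => by rw [norm_rankOne])
  have hT : (∑' i : N × M, rankOne ℂ (htmul (x i.1) (u i.2)) (htmul (y i.1) (v i.2))) =
      _root_.tensorOp A B := by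
    refine hilbertTensor_ext fun a b => ?_
    rw [tensorOp_htmul]
    have e1 := h1.mapL (ContinuousLinearMap.apply ℂ H a)
    have e2 := h3.mapL (ContinuousLinearMap.apply ℂ Z b)
    have e3 := hS.hasSum.mapL (ContinuousLinearMap.apply ℂ (HilbertTensor H Z) (htmul a b))
    have e4 : ∀ i, HasSum (fun j => rankOne ℂ (htmul (x i) (u j)) (htmul (y i) (v j)) (htmul a b))
        (htmulL (rankOne ℂ (x i) (y i) a) (B b)) := by
      intro i
      refine (e2.mapL (htmulL (rankOne ℂ (x i) (y i) a))).congr_fun fun j => ?_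
      change _ = htmulL _ (rankOne ℂ (u j) (v j) b)
      rw [rankOne_apply, rankOne_apply, rankOne_apply, htmul_inner, map_smul, map_smul,
        smul_apply, smul_smul, mul_comm]
      rfl
    have e5 := e3.prod_fiberwise e4
    have e6 := e1.mapL ((htmulL (H := H) (Z := Z)).flip (B b))
    exact e5.unique e6
  have hN : HasSum (fun i : N × M =>
      rankOne ℂ (htmul (x i.1) (u i.2)) (htmul (y i.1) (v i.2))) (_root_.tensorOp A B) :=
    hT ▸ hS.hasSum
  exact (nuclear_isTraceClass hN hs).1

variable [CompleteSpace H] [CompleteSpace Z]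

/-- `A ⊗ B` as a trace-class operator on `H ⊗ Z`. -/
noncomputable def TraceClass.tensor (A : TraceClass H) (B : TraceClass Z) :
    TraceClass (HilbertTensor H Z) :=
  TraceClass.mk (tensorOp A.toCLM B.toCLM) (A.isTraceClass.tensorOp B.isTraceClass)

end Tensor

section Choi

variable {H Z J : Type*} [NormedAddCommGroup H] [InnerProductSpace ℂ H] [CompleteSpace H]
  [NormedAddCommGroup Z] [InnerProductSpace ℂ Z] [CompleteSpace Z]

/-- The `(j, k)` summand `conj λ_j λ_k |g_j⟩⟨g_k| ⊗ Φ(|g_j⟩⟨g_k|)` of the weighted Choi operator. -/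
noncomputable def choiTerm (l : lp (fun _ : J => ℂ) 1) (g : HilbertBasis J ℂ H)
    (Φ : TraceClass H →L[ℂ] TraceClass Z) (p : J × J) : TraceClass (HilbertTensor H Z) :=
  (starRingEnd ℂ (l p.1) * l p.2) •
    (TraceClass.ketbra (g p.1) (g p.2)).tensor (Φ (TraceClass.ketbra (g p.1) (g p.2)))

/-- The weighted Choi map: the (unordered, trace-norm) sum of all the summands `choiTerm`. -/
noncomputable def choiMap (l : lp (fun _ : J => ℂ) 1) (g : HilbertBasis J ℂ H)
    (Φ : TraceClass H →L[ℂ] TraceClass Z) : TraceClass (HilbertTensor H Z) :=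
  ∑' p : J × J, choiTerm l g Φ p

end Choi

/-! ### Completeness of the trace class and its rank-one generators. -/

section TraceClassComplete

variable {H : Type*} [NormedAddCommGroup H] [InnerProductSpace ℂ H]

/-! Everything rests on the block identity `inner_choiMap_apply`: the (j, k) block of the Choi
operator is conj λ_j λ_k Φ(|g_j⟩⟨g_k|). The sum defining it converges because the trace class is
complete and the terms are dominated by |λ_j| |λ_k| ‖Φ‖.

If no weight vanishes, the blocks recover Φ on all |g_j⟩⟨g_k|, which span a trace-norm dense
subspace; a vanishing λ_j erases row and column j, which ruins injectivity and surjectivity.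
Separability comes for free, as an ℓ¹ family has countable support. In finite dimension Φ is read
off from the blocks of Y by dividing by the weights.

In infinite dimension boundedness of Φ is the obstruction (`choiMap_ne_of_hasSum`). It forces ⟨g_j ⊗
z, Y (g_j ⊗ z)⟩ ≤ |λ_j|² ‖Φ‖, so the square roots of these diagonal entries are summable. For Y = ∑
(n+1)⁻² |e_n ⊗ z⟩⟨e_n ⊗ z| Cauchy–Schwarz and Parseval then bound the harmonic series, whatever the
basis and the weights are. -/

theorem IsTraceClass.opNorm_le_traceNorm {X : H →L[ℂ] H} (hX : IsTraceClass X) :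
    ‖X‖ ≤ traceNorm X := by
  obtain ⟨N, x, y, h1, h2⟩ := hX.exists_nuclear
  have h3 := h2.congr_fun fun i => norm_rankOne (𝕜 := ℂ) (x i) (y i)
  rw [← h3.tsum_eq]
  conv_lhs => rw [← h1.tsum_eq]
  exact norm_tsum_le_tsum_norm h3.summable

variable [CompleteSpace H]

/-- The inclusion of the trace class into the bounded operators, as a bounded map. -/
noncomputable def TraceClass.toCLML : TraceClass H →L[ℂ] (H →L[ℂ] H) :=
  TraceClass.toCLM.mkContinuous 1 fun X => by
    rw [one_mul]
    exact X.isTraceClass.opNorm_le_traceNorm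

/-- The matrix element `X ↦ ⟪a, X b⟫` as a bounded functional on the trace class. -/
noncomputable def TraceClass.matrixElement (a b : H) : TraceClass H →L[ℂ] ℂ :=
  innerSL ℂ a ∘L ContinuousLinearMap.apply ℂ H b ∘L TraceClass.toCLML

@[simp]
theorem TraceClass.matrixElement_apply (a b : H) (X : TraceClass H) :
    TraceClass.matrixElement a b X = ⟪a, X.toCLM b⟫_ℂ := rfl

@[simp]
theorem TraceClass.toCLM_ketbra (x y : H) : (TraceClass.ketbra x y).toCLM = rankOne ℂ x y := rfl

@[simp]
theorem TraceClass.toCLM_mk (X : H →L[ℂ] H) (hX : IsTraceClass X) :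
    (TraceClass.mk X hX).toCLM = X := rfl

theorem TraceClass.norm_ketbra_le (x y : H) : ‖TraceClass.ketbra x y‖ ≤ ‖x‖ * ‖y‖ := by
  have h := (nuclear_isTraceClass (ι := Unit) (x := fun _ => x) (y := fun _ => y)
    (hasSum_unique _) (hasSum_unique _).summable).2
  rwa [tsum_const, Nat.card_unique, one_smul] at h

/-- Each term has a nuclear expansion of total weight exactly its trace norm; together these form
one nuclear expansion of the sum. Convergence is assumed only in operator norm. -/
theorem isTraceClass_of_hasSum {ι : Type*} {X : ι → TraceClass H} {T : H →L[ℂ] H}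
    (hT : HasSum (fun i => (X i).toCLM) T) (hs : Summable fun i => ‖X i‖) :
    IsTraceClass T ∧ traceNorm T ≤ ∑' i, ‖X i‖ := by
  have h0 : ∀ i, ∃ (N : Set ℕ) (x y : N → H), HasSum (fun n => rankOne ℂ (x n) (y n)) (X i).toCLM ∧
      HasSum (fun n => ‖x n‖ * ‖y n‖) ‖X i‖ := fun i => (X i).isTraceClass.exists_nuclear
  choose N x y h1 h2 using h0
  have h3 : HasSum (fun p : Σ i, N i => ‖x p.1 p.2‖ * ‖y p.1 p.2‖) (∑' i, ‖X i‖) := by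
    refine HasSum.sigma_of_hasSum (f := fun p : Σ i, N i => ‖x p.1 p.2‖ * ‖y p.1 p.2‖)
      hs.hasSum h2 ?_
    refine (summable_sigma_of_nonneg fun p => by positivity).2 ⟨fun i => (h2 i).summable, ?_⟩
    exact hs.congr fun i => ((h2 i).tsum_eq).symm
  have h4 : Summable fun p : Σ i, N i => rankOne ℂ (x p.1 p.2) (y p.1 p.2) :=
    Summable.of_norm (h3.summable.congr fun p => (norm_rankOne _ _).symm)
  have h6 : HasSum (fun p : Σ i, N i => rankOne ℂ (x p.1 p.2) (y p.1 p.2)) T :=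
    HasSum.sigma_of_hasSum (f := fun p : Σ i, N i => rankOne ℂ (x p.1 p.2) (y p.1 p.2)) hT h1 h4
  have h5 := nuclear_isTraceClass h6 h3.summable
  exact ⟨h5.1, h5.2.trans_eq h3.tsum_eq⟩

/-- The remainder after a finite partial sum is the operator-norm sum of the omitted terms, so its
trace norm is at most the tail of ∑ ‖X i‖. This upgrades operator-norm limits to trace-norm limits.
-/
theorem TraceClass.hasSum_of_hasSum_toCLM {ι : Type*} {X : ι → TraceClass H} {T : TraceClass H}
    (hT : HasSum (fun i => (X i).toCLM) T.toCLM) (hs : Summable fun i => ‖X i‖) :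
    HasSum X T := by
  rw [HasSum, SummationFilter.unconditional_filter, tendsto_iff_norm_sub_tendsto_zero]
  refine squeeze_zero (fun _ => norm_nonneg _) (fun F => ?_)
    (tendsto_tsum_compl_atTop_zero fun i => ‖X i‖)
  have h1 : HasSum (fun i : {i // i ∉ F} => (X i).toCLM) (T - ∑ i ∈ F, X i).toCLM := by
    rw [map_sub, map_sum]
    exact (F.hasSum_compl_iff (f := fun i => (X i).toCLM)).2 (by simpa using hT)
  rw [norm_sub_rev]
  exact (isTraceClass_of_hasSum h1 (hs.subtype _)).2

instance TraceClass.instCompleteSpace : CompleteSpace (TraceClass H) := by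
  refine NormedAddCommGroup.completeSpace_of_summable_imp_tendsto fun X hX => ?_
  have h1 : Summable fun i => (X i).toCLM :=
    Summable.of_norm_bounded hX fun i => (X i).isTraceClass.opNorm_le_traceNorm
  have h2 := isTraceClass_of_hasSum h1.hasSum hX
  exact ⟨TraceClass.mk _ h2.1,
    (TraceClass.hasSum_of_hasSum_toCLM (T := TraceClass.mk _ h2.1) h1.hasSum hX).tendsto_sum_nat⟩

/-- `|x⟩⟨y|` is continuous and linear in `x`. -/
noncomputable def TraceClass.ketbraLeft (y : H) : H →L[ℂ] TraceClass H :=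
  LinearMap.mkContinuous
    { toFun := fun x => TraceClass.ketbra x y
      map_add' := fun a b => TraceClass.toCLM_injective (by simp)
      map_smul' := fun c a => TraceClass.toCLM_injective (by simp) } ‖y‖ fun x => by
    rw [mul_comm]
    exact TraceClass.norm_ketbra_le x y

/-- `|x⟩⟨y|` is continuous and conjugate-linear in `y`. -/
noncomputable def TraceClass.ketbraRight (x : H) : H →L⋆[ℂ] TraceClass H :=
  LinearMap.mkContinuous
    { toFun := fun y => TraceClass.ketbra x y
      map_add' := fun a b => TraceClass.toCLM_injective (by simp)
      map_smul' := fun c a => TraceClass.toCLM_injective (by simp) } ‖x‖ fun y =>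
    TraceClass.norm_ketbra_le x y

/-- Density of the span of the basis is used twice, linearly in the ket and conjugate-linearly in
the bra; a nuclear expansion, which converges in trace norm, then reaches every trace-class
operator. -/
theorem TraceClass.ext_ketbra {E J : Type*} [NormedAddCommGroup E] [NormedSpace ℂ E]
    (g : HilbertBasis J ℂ H) {S T : TraceClass H →L[ℂ] E}
    (h : ∀ j k, S (TraceClass.ketbra (g j) (g k)) = T (TraceClass.ketbra (g j) (g k))) :
    S = T := by
  have hd : Dense (Submodule.span ℂ (Set.range g) : Set H) :=
    Submodule.dense_iff_topologicalClosure_eq_top.2 g.dense_span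
  have h1 : ∀ x k, S (TraceClass.ketbra x (g k)) = T (TraceClass.ketbra x (g k)) := by
    intro x k
    have : S ∘L TraceClass.ketbraLeft (g k) = T ∘L TraceClass.ketbraLeft (g k) := by
      refine ContinuousLinearMap.ext_on hd ?_
      rintro _ ⟨j, rfl⟩
      exact h j k
    exact DFunLike.congr_fun this x
  have h2 : ∀ x y, S (TraceClass.ketbra x y) = T (TraceClass.ketbra x y) := by
    intro x y
    have : S.comp (TraceClass.ketbraRight x) = T.comp (TraceClass.ketbraRight x) := by
      refine ContinuousLinearMap.ext_on hd ?_
      rintro _ ⟨k, rfl⟩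
      exact h1 x k
    exact DFunLike.congr_fun this y
  ext X
  obtain ⟨N, x, y, h3, h4⟩ := X.isTraceClass.exists_nuclear
  have h5 : HasSum (fun i => TraceClass.ketbra (x i) (y i)) X :=
    TraceClass.hasSum_of_hasSum_toCLM h3
      (Summable.of_nonneg_of_le (fun _ => norm_nonneg _)
        (fun i => TraceClass.norm_ketbra_le (x i) (y i)) h4.summable)
  exact (h5.mapL S).unique ((h5.mapL T).congr_fun fun i => h2 _ _)

/-- A nuclear expansion is carried along termwise by |x⟩⟨y| ↦ |A x⟩⟨B* y|. This is what makes the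
blocks of an operator on the tensor product trace class. -/
theorem IsTraceClass.comp_comp {K : Type*} [NormedAddCommGroup K] [InnerProductSpace ℂ K]
    [CompleteSpace K] {X : H →L[ℂ] H} (hX : IsTraceClass X) (A : H →L[ℂ] K) (B : K →L[ℂ] H) :
    IsTraceClass (A ∘L X ∘L B) := by
  obtain ⟨N, x, y, h1, h2⟩ := hX.exists_nuclear
  have h3 : HasSum (fun i => rankOne ℂ (A (x i)) (B.adjoint (y i))) (A ∘L X ∘L B) := by
    have h4 := (h1.mapL ((ContinuousLinearMap.compL ℂ K H H).flip B)).mapL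
      (ContinuousLinearMap.compL ℂ K H K A)
    refine h4.congr_fun fun i => ?_
    ext v
    simp [ContinuousLinearMap.adjoint_inner_left]
  refine (nuclear_isTraceClass h3 ?_).1
  refine Summable.of_nonneg_of_le (fun i => by positivity) (fun i => ?_)
    (h2.summable.mul_left (‖A‖ * ‖B.adjoint‖))
  calc _ ≤ (‖A‖ * ‖x i‖) * (‖B.adjoint‖ * ‖y i‖) := by
        gcongr <;> exact ContinuousLinearMap.le_opNorm _ _
    _ = _ := by ring

end TraceClassComplete

/-! ### Operators on the Hilbert tensor product: matrix elements and a norm bound. -/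

section Tensor

variable {H Z J : Type*} [NormedAddCommGroup H] [InnerProductSpace ℂ H]
  [NormedAddCommGroup Z] [InnerProductSpace ℂ Z]

@[simp]
theorem htmulL_apply (x : H) (z : Z) : htmulL x z = htmul x z := rfl

theorem hilbertTensor_ext_basis {E : Type*} [NormedAddCommGroup E] [NormedSpace ℂ E]
    (g : HilbertBasis J ℂ H) {S T : HilbertTensor H Z →L[ℂ] E}
    (h : ∀ j z, S (htmul (g j) z) = T (htmul (g j) z)) : S = T := by
  have hd : Dense (Submodule.span ℂ (Set.range g) : Set H) :=
    Submodule.dense_iff_topologicalClosure_eq_top.2 g.dense_span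
  refine hilbertTensor_ext fun x z => ?_
  have : S ∘L (htmulL (H := H) (Z := Z)).flip z = T ∘L (htmulL (H := H) (Z := Z)).flip z := by
    refine ContinuousLinearMap.ext_on hd ?_
    rintro _ ⟨j, rfl⟩
    exact h j z
  exact DFunLike.congr_fun this x

theorem hilbertTensor_ext_inner (g : HilbertBasis J ℂ H)
    {S T : HilbertTensor H Z →L[ℂ] HilbertTensor H Z}
    (h : ∀ j k a b, ⟪htmul (g j) a, S (htmul (g k) b)⟫_ℂ = ⟪htmul (g j) a, T (htmul (g k) b)⟫_ℂ) :
    S = T := by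
  refine hilbertTensor_ext_basis g fun k b => ext_inner_left ℂ fun v => ?_
  have : innerSL ℂ (S (htmul (g k) b)) = innerSL ℂ (T (htmul (g k) b)) :=
    hilbertTensor_ext_basis g fun j a => by
      -- Conjugation moves the varying vector g_j ⊗ a into the linear slot, where extension by
      -- density applies.
      have := congrArg (starRingEnd ℂ) (h j k a b)
      simpa only [innerSL_apply_apply, inner_conj_symm] using this
  have h2 := congrArg (starRingEnd ℂ) (DFunLike.congr_fun this v)
  simpa only [innerSL_apply_apply, inner_conj_symm] using h2

variable [CompleteSpace H] [CompleteSpace Z]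

/-- Tensoring a nuclear expansion ∑ |u_i⟩⟨v_i| of B with x and y gives the expansion ∑ |x ⊗ u_i⟩⟨y ⊗
v_i|, of weight ‖x‖ ‖y‖ ‖B‖. -/
theorem TraceClass.norm_ketbra_tensor_le (x y : H) (B : TraceClass Z) :
    ‖(TraceClass.ketbra x y).tensor B‖ ≤ ‖x‖ * ‖y‖ * ‖B‖ := by
  obtain ⟨M, u, v, h1, h2⟩ := B.isTraceClass.exists_nuclear
  have hs : HasSum (fun i => ‖htmul x (u i)‖ * ‖htmul y (v i)‖) (‖x‖ * ‖y‖ * ‖B‖) := by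
    refine (h2.mul_left (‖x‖ * ‖y‖)).congr_fun fun i => ?_
    rw [htmul_norm, htmul_norm]; ring
  have hS : Summable fun i => rankOne ℂ (htmul x (u i)) (htmul y (v i)) :=
    Summable.of_norm (hs.summable.congr fun i => (norm_rankOne _ _).symm)
  have hT : (∑' i, rankOne ℂ (htmul x (u i)) (htmul y (v i))) =
      tensorOp (rankOne ℂ x y) B.toCLM := by
    refine hilbertTensor_ext fun a b => ?_
    have e1 := hS.hasSum.mapL (ContinuousLinearMap.apply ℂ (HilbertTensor H Z) (htmul a b))
    have e2 := (h1.mapL (ContinuousLinearMap.apply ℂ Z b)).mapL (htmulL (rankOne ℂ x y a))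
    rw [tensorOp_htmul]
    refine e1.unique (e2.congr_fun fun i => ?_)
    change _ = htmulL _ (rankOne ℂ (u i) (v i) b)
    change rankOne ℂ (htmul x (u i)) (htmul y (v i)) (htmul a b) = _
    rw [rankOne_apply, rankOne_apply, rankOne_apply, htmul_inner, map_smul, map_smul,
      smul_apply, smul_smul, mul_comm]
    rfl
  have hN := hS.hasSum
  rw [hT] at hN
  exact (nuclear_isTraceClass hN hs.summable).2.trans_eq hs.tsum_eq

end Tensor

/-! ### The weighted Choi map: convergence, blocks, injectivity, surjectivity. -/

section ChoiMap

variable {H Z J : Type*} [NormedAddCommGroup H] [InnerProductSpace ℂ H] [CompleteSpace H]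
  [NormedAddCommGroup Z] [InnerProductSpace ℂ Z] [CompleteSpace Z]
  (l : lp (fun _ : J => ℂ) 1) (g : HilbertBasis J ℂ H)

theorem lp_one_summable_norm {J : Type*} (l : lp (fun _ : J => ℂ) 1) :
    Summable fun j => ‖l j‖ := by
  simpa using (lp.memℓp l).summable (by simp)

theorem norm_ketbra_basis_le (j k : J) : ‖TraceClass.ketbra (g j) (g k)‖ ≤ 1 := by
  simpa [g.orthonormal.1] using TraceClass.norm_ketbra_le (g j) (g k)

theorem summable_choiTerm (Φ : TraceClass H →L[ℂ] TraceClass Z) :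
    Summable (choiTerm l g Φ) := by
  have h := lp_one_summable_norm l
  have h2 := (h.mul_of_nonneg h (fun _ => norm_nonneg _) (fun _ => norm_nonneg _)).mul_right ‖Φ‖
  refine Summable.of_norm_bounded h2 fun p => ?_
  rw [choiTerm, norm_smul, norm_mul, RCLike.norm_conj]
  gcongr
  refine (TraceClass.norm_ketbra_tensor_le _ _ _).trans ?_
  rw [g.orthonormal.1, g.orthonormal.1, one_mul, one_mul]
  exact Φ.le_opNorm_of_le (norm_ketbra_basis_le g p.1 p.2) |>.trans_eq (mul_one _)

/-- Matrix elements are continuous in trace norm, so they pass through the sum, and orthonormality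
of the basis kills every term except (j, k). -/
theorem inner_choiMap_apply (Φ : TraceClass H →L[ℂ] TraceClass Z) (j k : J) (a b : Z) :
    ⟪htmul (g j) a, (choiMap l g Φ).toCLM (htmul (g k) b)⟫_ℂ =
      starRingEnd ℂ (l j) * l k * ⟪a, (Φ (TraceClass.ketbra (g j) (g k))).toCLM b⟫_ℂ := by
  classical
  have h1 := (summable_choiTerm l g Φ).hasSum.mapL
    (TraceClass.matrixElement (htmul (g j) a) (htmul (g k) b))
  have hg := orthonormal_iff_ite.1 g.orthonormal
  refine h1.unique (HasSum.congr_fun (hasSum_ite_eq (j, k) _) fun p => ?_)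
  rw [TraceClass.matrixElement_apply, choiTerm, map_smul, smul_apply, inner_smul_right]
  change _ * ⟪_, tensorOp _ _ _⟫_ℂ = _
  rw [tensorOp_htmul, htmul_inner, TraceClass.toCLM_ketbra, rankOne_apply, inner_smul_right,
    hg, hg]
  by_cases h : p = (j, k)
  · subst h
    simp
  · rw [if_neg h]
    by_cases h2 : j = p.1
    · have h3 : p.2 ≠ k := fun h3 => h (Prod.ext h2.symm h3)
      simp [h3]
    · simp [h2]

theorem HilbertBasis.separableSpace_of_lp_one_ne_zero {H J : Type*} [NormedAddCommGroup H]
    [InnerProductSpace ℂ H] (g : HilbertBasis J ℂ H) (l : lp (fun _ : J => ℂ) 1)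
    (hl : ∀ j, l j ≠ 0) : TopologicalSpace.SeparableSpace H := by
  have hc : Countable J := by
    have h := (lp_one_summable_norm l).countable_support
    rwa [show (Function.support fun j => ‖l j‖) = Set.univ from
      Set.eq_univ_of_forall fun j => norm_ne_zero_iff.2 (hl j), Set.countable_univ_iff] at h
  have h1 : TopologicalSpace.IsSeparable (Submodule.span ℂ (Set.range g) : Set H) :=
    (Set.countable_range g).isSeparable.span
  have h2 := h1.closure
  rw [(Submodule.dense_iff_topologicalClosure_eq_top.2 g.dense_span).closure_eq] at h2
  exact TopologicalSpace.isSeparable_univ_iff.1 h2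

theorem choiMap_injective (hl : ∀ j, l j ≠ 0) : Function.Injective (choiMap (Z := Z) l g) := by
  intro Φ Ψ h
  refine TraceClass.ext_ketbra g fun j k => TraceClass.toCLM_injective ?_
  ext b
  refine ext_inner_left ℂ fun a => ?_
  have h1 := inner_choiMap_apply l g Φ j k a b
  rw [h, inner_choiMap_apply] at h1
  have h2 : starRingEnd ℂ (l j) * l k ≠ 0 :=
    mul_ne_zero ((map_ne_zero _).2 (hl j)) (hl k)
  exact (mul_left_cancel₀ h2 h1).symm

/-- If λ_j = 0, the nonzero map X ↦ ⟨g_j, X g_j⟩ |z⟩⟨z| has the same image as 0: its only nonzero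
block is (j, j), which carries weight |λ_j|². -/
theorem ne_zero_of_choiMap_injective [Nontrivial Z]
    (h : Function.Injective (choiMap (Z := Z) l g)) (j : J) : l j ≠ 0 := by
  classical
  intro hj
  obtain ⟨z, hz⟩ := exists_ne (0 : Z)
  obtain ⟨Φ, hΦ⟩ : ∃ Φ : TraceClass H →L[ℂ] TraceClass Z,
      Φ = (TraceClass.matrixElement (g j) (g j)).smulRight (TraceClass.ketbra z z) := ⟨_, rfl⟩
  have hg := orthonormal_iff_ite.1 g.orthonormal
  have h1 : ∀ a b, Φ (TraceClass.ketbra (g a) (g b)) =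
      ((if b = j then (1 : ℂ) else 0) * if j = a then 1 else 0) • TraceClass.ketbra z z := by
    intro a b
    rw [hΦ, ContinuousLinearMap.smulRight_apply, TraceClass.matrixElement_apply,
      TraceClass.toCLM_ketbra, rankOne_apply, inner_smul_right, hg, hg]
  have h2 : choiMap l g Φ = choiMap l g 0 := by
    refine TraceClass.toCLM_injective (hilbertTensor_ext_inner g fun a b u v => ?_)
    rw [inner_choiMap_apply, inner_choiMap_apply, h1]
    by_cases ha : j = a
    · subst ha
      simp [hj]
    · simp [ha]
  -- Injectivity would make this map zero, yet its value |z⟩⟨z| at |g_j⟩⟨g_j| has norm ‖z‖².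
  have h3 := h1 j j
  rw [h h2] at h3
  have h4 := congrArg (fun X => ‖X.toCLM‖) h3
  simp [hz] at h4

/-- If λ_j = 0, every operator in the range has zero (j, j) block, unlike the projection-like
operator |g_j ⊗ z⟩⟨g_j ⊗ z|. -/
theorem ne_zero_of_choiMap_surjective [Nontrivial Z]
    (h : Function.Surjective (choiMap (Z := Z) l g)) (j : J) : l j ≠ 0 := by
  intro hj
  obtain ⟨z, hz⟩ := exists_ne (0 : Z)
  obtain ⟨Φ, hΦ⟩ := h (TraceClass.ketbra (htmul (g j) z) (htmul (g j) z))
  have h1 := inner_choiMap_apply l g Φ j j z z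
  rw [hΦ, hj] at h1
  have h2 : htmul (g j) z ≠ 0 := by
    rw [← norm_ne_zero_iff, htmul_norm, g.orthonormal.1, one_mul]
    exact norm_ne_zero_iff.2 hz
  simp [inner_smul_right, h2] at h1

theorem choiMap_surjective [FiniteDimensional ℂ H] (hl : ∀ j, l j ≠ 0) :
    Function.Surjective (choiMap (Z := Z) l g) := by
  classical
  intro Y
  have hJ : Finite J := g.orthonormal.linearIndependent.finite
  have := Fintype.ofFinite J
  -- The (j, k) block of Y, an operator on Z. Dividing by the weight gives the required value of Φ
  -- at |g_j⟩⟨g_k|; since J is finite, Φ is a finite sum and hence bounded.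
  let B : J → J → TraceClass Z := fun j k => TraceClass.mk
    ((htmulL (g j)).adjoint ∘L Y.toCLM ∘L htmulL (g k)) (Y.isTraceClass.comp_comp _ _)
  let Φ : TraceClass H →L[ℂ] TraceClass Z := ∑ j, ∑ k,
    (TraceClass.matrixElement (g j) (g k)).smulRight ((starRingEnd ℂ (l j) * l k)⁻¹ • B j k)
  have hg := orthonormal_iff_ite.1 g.orthonormal
  have h1 : ∀ j k, Φ (TraceClass.ketbra (g j) (g k)) = (starRingEnd ℂ (l j) * l k)⁻¹ • B j k := by
    intro j k
    have h2 : ∀ a b, TraceClass.matrixElement (g a) (g b) (TraceClass.ketbra (g j) (g k)) =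
        (if k = b then 1 else 0) * if a = j then 1 else 0 := fun a b => by
      rw [TraceClass.matrixElement_apply, TraceClass.toCLM_ketbra, rankOne_apply,
        inner_smul_right, hg, hg]
    simp only [Φ, sum_apply, ContinuousLinearMap.smulRight_apply, h2]
    simp
  refine ⟨Φ, TraceClass.toCLM_injective (hilbertTensor_ext_inner g fun j k a b => ?_)⟩
  have h2 : starRingEnd ℂ (l j) * l k ≠ 0 :=
    mul_ne_zero ((map_ne_zero _).2 (hl j)) (hl k)
  rw [inner_choiMap_apply, h1, map_smul, smul_apply, inner_smul_right, mul_inv_cancel_left₀ h2]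
  simp only [B, TraceClass.toCLM_mk, ContinuousLinearMap.comp_apply,
    ContinuousLinearMap.adjoint_inner_right, htmulL_apply]

end ChoiMap

/-! ### A positive operator outside the range of every weighted Choi map. -/

section NotInRange

variable {H Z : Type*} [NormedAddCommGroup H] [InnerProductSpace ℂ H]
  [NormedAddCommGroup Z] [InnerProductSpace ℂ Z]

/-- For an orthonormal sequence `e` and a unit vector `z`, the positive trace-class operator
`∑ₙ (n + 1)⁻² |eₙ ⊗ z⟩⟨eₙ ⊗ z|`. -/
theorem exists_positive_traceClass {e : ℕ → H} (he : Orthonormal ℂ e) {z : Z} (hz : ‖z‖ = 1) :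
    ∃ Y : TraceClass (HilbertTensor H Z), Y.toCLM.IsPositive ∧
      ∀ x : H, HasSum (fun n : ℕ => ((n : ℝ) + 1)⁻¹ ^ 2 * ‖⟪e n, x⟫_ℂ‖ ^ 2)
        (RCLike.re ⟪htmul x z, Y.toCLM (htmul x z)⟫_ℂ) := by
  -- The exponent matters: the weights (n+1)⁻² of |v_n⟩⟨v_n| are summable, their square roots are
  -- not.
  let v : ℕ → HilbertTensor H Z := fun n => ((((n : ℝ) + 1)⁻¹ : ℝ) : ℂ) • htmul (e n) z
  have hv : ∀ n, ‖v n‖ = ((n : ℝ) + 1)⁻¹ := by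
    intro n
    rw [norm_smul, htmul_norm, he.1, hz, mul_one, mul_one, Complex.norm_real,
      Real.norm_of_nonneg (by positivity)]
  have hs : Summable fun n => ‖v n‖ * ‖v n‖ := by
    have h1 : Summable fun n : ℕ => (((n : ℝ)) ^ 2)⁻¹ := Real.summable_nat_pow_inv.2 (by norm_num)
    refine ((summable_nat_add_iff 1).2 h1).congr fun n => ?_
    rw [hv]; push_cast; rw [← sq, inv_pow]
  have hS : Summable fun n => rankOne ℂ (v n) (v n) :=
    Summable.of_norm (hs.congr fun i => (norm_rankOne _ _).symm)
  have hq : ∀ w, HasSum (fun n => ‖⟪v n, w⟫_ℂ‖ ^ 2)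
      (RCLike.re ⟪w, (∑' n, rankOne ℂ (v n) (v n)) w⟫_ℂ) := by
    intro w
    have h2 := ((hS.hasSum.mapL (ContinuousLinearMap.apply ℂ _ w)).mapL (innerSL ℂ w)).mapL
      Complex.reCLM
    refine h2.congr_fun fun n => ?_
    change _ = RCLike.re ⟪w, rankOne ℂ (v n) (v n) w⟫_ℂ
    rw [rankOne_apply, inner_smul_right, ← inner_conj_symm w, RCLike.mul_conj]
    norm_cast
  refine ⟨TraceClass.mk _ (nuclear_isTraceClass hS.hasSum hs).1, ?_, fun x => ?_⟩
  · rw [TraceClass.toCLM_mk]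
    refine ContinuousLinearMap.isPositive_def'.2 ⟨?_, fun w => ?_⟩
    · rw [IsSelfAdjoint, tsum_star]
      refine tsum_congr fun n => ?_
      rw [ContinuousLinearMap.star_eq_adjoint, adjoint_rankOne]
    · rw [ContinuousLinearMap.reApplyInnerSelf_apply, ← inner_re_symm]
      exact (hq w).nonneg fun n => by positivity
  · refine (hq (htmul x z)).congr_fun fun n => ?_
    have : v n = ((((n : ℝ) + 1)⁻¹ : ℝ) : ℂ) • htmul (e n) z := rfl
    rw [this, inner_smul_left, htmul_inner, inner_self_eq_norm_sq_to_K, hz, norm_mul, norm_mul,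
      RCLike.norm_conj, Complex.norm_real, Real.norm_of_nonneg (by positivity)]
    simp [mul_pow]

variable [CompleteSpace H] [CompleteSpace Z]

theorem exists_orthonormal_nat (h : ¬ FiniteDimensional ℂ H) : ∃ e : ℕ → H, Orthonormal ℂ e := by
  obtain ⟨w, b, hb⟩ := exists_hilbertBasis ℂ H
  have hw : Infinite w := by
    rw [← not_finite_iff_infinite]
    intro hf
    apply h
    have h1 : (Submodule.span ℂ (Set.range b)).topologicalClosure = ⊤ := b.dense_span
    have h2 : FiniteDimensional ℂ (Submodule.span ℂ (Set.range b)) :=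
      FiniteDimensional.span_of_finite ℂ (Set.finite_range b)
    rw [(Submodule.closed_of_finiteDimensional _).submodule_topologicalClosure_eq] at h1
    rw [h1] at h2
    exact Module.Finite.equiv (Submodule.topEquiv (R := ℂ) (M := H))
  exact ⟨_, b.orthonormal.comp _ (Infinite.natEmbedding w).injective⟩

/-- A preimage would bound ∑ (n+1)⁻¹ by ‖λ‖₁ √‖Φ‖. Since Y is fixed before the basis and the
weights, one operator serves for all of them. -/
theorem choiMap_ne_of_hasSum {J : Type*} {e : ℕ → H} (he : Orthonormal ℂ e) {z : Z} (hz : ‖z‖ = 1)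
    {Y : TraceClass (HilbertTensor H Z)}
    (hY : ∀ x : H, HasSum (fun n : ℕ => ((n : ℝ) + 1)⁻¹ ^ 2 * ‖⟪e n, x⟫_ℂ‖ ^ 2)
        (RCLike.re ⟪htmul x z, Y.toCLM (htmul x z)⟫_ℂ))
    (l : lp (fun _ : J => ℂ) 1) (g : HilbertBasis J ℂ H)
    (Φ : TraceClass H →L[ℂ] TraceClass Z) : choiMap l g Φ ≠ Y := by
  intro hΦ
  have hl := lp_one_summable_norm l
  have hdiag : ∀ j, RCLike.re ⟪htmul (g j) z, Y.toCLM (htmul (g j) z)⟫_ℂ ≤ ‖l j‖ ^ 2 * ‖Φ‖ := by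
    intro j
    rw [← hΦ, inner_choiMap_apply]
    refine (RCLike.re_le_norm _).trans ?_
    rw [norm_mul, norm_mul, RCLike.norm_conj, ← sq]
    gcongr
    refine (norm_inner_le_norm _ _).trans ?_
    rw [hz, one_mul]
    refine (ContinuousLinearMap.le_opNorm _ _).trans ?_
    rw [hz, mul_one]
    refine (Φ _).isTraceClass.opNorm_le_traceNorm.trans ?_
    exact Φ.le_opNorm_of_le (norm_ketbra_basis_le g j j) |>.trans_eq (mul_one _)
  -- Cauchy–Schwarz with one factor |⟨e_n, g_j⟩| split off: Bessel bounds the second sum by 1, and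
  -- the diagonal entry of Y bounds the first. This turns |λ_j|² into the summable |λ_j|.
  have hsqrt : ∀ (F : Finset ℕ) j,
      ∑ n ∈ F, ((n : ℝ) + 1)⁻¹ * ‖⟪e n, g j⟫_ℂ‖ ^ 2 ≤ ‖l j‖ * √‖Φ‖ := by
    intro F j
    calc _ = ∑ n ∈ F, (((n : ℝ) + 1)⁻¹ * ‖⟪e n, g j⟫_ℂ‖) * ‖⟪e n, g j⟫_ℂ‖ :=
          Finset.sum_congr rfl fun n _ => by ring
      _ ≤ √(∑ n ∈ F, (((n : ℝ) + 1)⁻¹ * ‖⟪e n, g j⟫_ℂ‖) ^ 2) * √(∑ n ∈ F, ‖⟪e n, g j⟫_ℂ‖ ^ 2) :=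
          Real.sum_mul_le_sqrt_mul_sqrt _ _ _
      _ ≤ √(‖l j‖ ^ 2 * ‖Φ‖) * √1 := by
          gcongr
          · refine le_trans (le_of_eq (Finset.sum_congr rfl fun n _ => mul_pow _ _ _))
              ((sum_le_hasSum F (fun n _ => by positivity) (hY (g j))).trans (hdiag j))
          · simpa [g.orthonormal.1] using he.sum_inner_products_le (g j) (s := F)
      _ = ‖l j‖ * √‖Φ‖ := by
          rw [Real.sqrt_one, mul_one, Real.sqrt_mul (by positivity), Real.sqrt_sq (norm_nonneg _)]
  have hparseval : ∀ n, HasSum (fun j => ‖⟪e n, g j⟫_ℂ‖ ^ 2) 1 := by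
    intro n
    have h1 := g.hasSum_inner_mul_inner (e n) (e n)
    rw [inner_self_eq_norm_sq_to_K, he.1] at h1
    have h2 := h1.mapL Complex.reCLM
    simp only [RCLike.ofReal_one, one_pow] at h2
    refine h2.congr_fun fun j => ?_
    change _ = RCLike.re (⟪e n, g j⟫_ℂ * ⟪g j, e n⟫_ℂ)
    rw [← inner_conj_symm (g j), RCLike.mul_conj]
    norm_cast
  -- Summing over j with Parseval for each e_n removes the basis; as F is finite, the sums
  -- interchange freely.
  have hbound : ∀ F : Finset ℕ, ∑ n ∈ F, ((n : ℝ) + 1)⁻¹ ≤ (∑' j, ‖l j‖) * √‖Φ‖ := by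
    intro F
    have h1 : HasSum (fun j => ∑ n ∈ F, ((n : ℝ) + 1)⁻¹ * ‖⟪e n, g j⟫_ℂ‖ ^ 2)
        (∑ n ∈ F, ((n : ℝ) + 1)⁻¹) :=
      hasSum_sum fun n _ => by simpa using (hparseval n).mul_left ((n : ℝ) + 1)⁻¹
    exact hasSum_le (hsqrt F) h1 (hl.hasSum.mul_right _)
  have hsum : Summable fun n : ℕ => ((n : ℝ) + 1)⁻¹ :=
    summable_of_sum_le (fun n => by positivity) hbound
  refine Real.not_summable_natCast_inv ((summable_nat_add_iff 1).1 (hsum.congr fun n => ?_))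
  push_cast
  rfl

end NotInRange

/-! ### The proposition. -/

theorem proposition1 (H Z : Type*)
    [NormedAddCommGroup H] [InnerProductSpace ℂ H] [CompleteSpace H]
    [NormedAddCommGroup Z] [InnerProductSpace ℂ Z] [CompleteSpace Z] [Nontrivial Z] :
    (∀ (J : Type*) (g : HilbertBasis J ℂ H) (l : lp (fun _ : J => ℂ) 1),
      (∀ Φ : TraceClass H →L[ℂ] TraceClass Z, Summable (choiTerm l g Φ)) ∧
      (Function.Injective (choiMap (Z := Z) l g) ↔
        TopologicalSpace.SeparableSpace H ∧ ∀ j, l j ≠ 0) ∧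
      (Function.Surjective (choiMap (Z := Z) l g) ↔
        FiniteDimensional ℂ H ∧ ∀ j, l j ≠ 0)) ∧
    (¬ FiniteDimensional ℂ H →
      ∃ Y : TraceClass (HilbertTensor H Z), Y.toCLM.IsPositive ∧
        ∀ (J : Type*) (g : HilbertBasis J ℂ H) (l : lp (fun _ : J => ℂ) 1),
          choiMap (Z := Z) l g ⁻¹' {Y} = ∅) := by
  -- The real structure serves to pick a unit vector z in the nontrivial space Z.
  have : NormedSpace ℝ Z := NormedSpace.restrictScalars ℝ ℂ Z
  obtain ⟨z, hz⟩ := exists_norm_eq Z zero_le_one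
  refine ⟨fun J g l => ⟨summable_choiTerm l g, ⟨fun h => ?_, fun h => choiMap_injective l g h.2⟩,
    ⟨fun h => ⟨?_, ne_zero_of_choiMap_surjective l g h⟩, fun h => ?_⟩⟩, fun hH => ?_⟩
  · have hl := ne_zero_of_choiMap_injective l g h
    exact ⟨g.separableSpace_of_lp_one_ne_zero l hl, hl⟩
  · by_contra hH
    obtain ⟨e, he⟩ := exists_orthonormal_nat hH
    obtain ⟨Y, -, hY⟩ := exists_positive_traceClass he hz
    obtain ⟨Φ, hΦ⟩ := h Y
    exact choiMap_ne_of_hasSum he hz hY l g Φ hΦ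
  · have := h.1
    exact choiMap_surjective l g h.2
  · obtain ⟨e, he⟩ := exists_orthonormal_nat hH
    obtain ⟨Y, hpos, hY⟩ := exists_positive_traceClass he hz
    refine ⟨Y, hpos, fun J g l => Set.eq_empty_of_forall_notMem fun Φ hΦ => ?_⟩
    exact choiMap_ne_of_hasSum he hz hY l g Φ hΦ
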